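/- **Setting.** Let $T>0$, $I=[0,T]$, let $D\subset\mathbb{R}^d$ be a bounded Lipschitz domain, $Q=(0,T)\times D$, $\bar Q=[0,T]\times\bar D$. *Flows.* For a (pointwise defined) velocity $b\in L^\infty(\bar Q;\mathbb{R}^d)$ and $(t,x)\in\bar Q$ put $$\mathcal F_b(t,x)=\bigcap_{|\xi|=1}\{v\in\mathbb{R}^d:\ \xi\cdot v\le h(t,x,\xi)\},\qquad h(t,x,\xi)=\lim_{\delta\to0}\ \operatorname*{ess\,sup}_{y\in B_\delta(x)\cap\bar D}\xi\cdot b(t,y).$$ A Filippov solution of $\dot\gamma=b(t,\gamma)$, $\gamma(0)=x$, is an absolutely continuous $\gamma:I\to\bar D$ with $\gamma(0)=x$ and $\dot\gamma(t)\in\mathcal F_b(t,\gamma(t))$ for a.e. $t\in I$. A *forward untangled flow* of $b$ is a map $X:\bar Q\to\bar D$ such that $X(t,\cdot)$ is Borel for every $t\in I$, $X(\cdot,x)$ is a Filippov solution of $\dot\gamma=b(t,\gamma)$, $\gamma(0)=x$, for every $x\in\bar D$, and $X(s,x_1)=X(s,x_2)$ implies $X(t,x_1)=X(t,x_2)$ for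 all $s\le t\le T$. Given $X$, put $\varrho(t,\cdot)=X(t,\cdot)\#(\mathcal L^d\llcorner D)$ and $\sigma(dz,dt)=\varrho(t,dz)\,dt$ on $\bar Q$. *Variational solutions.* For $C\in L^\infty(Q)$, $C\ge0$, $F\in L^2(Q)$, $\bar U\in L^2(D)$, let $\mathcal Y$ be the closure of the set of all $V\in C(\bar Q)\cap C^1(Q)$ with $V(T,\cdot)=0$ and $\mathcal B_\circ^*V:=-\partial_tV+CV\in L^2(Q)$ with respect to the norm $\|\mathcal B_\circ^*V\|_{L^2(Q)}$, and let $\mathcal B^*:\mathcal Y\to L^2(Q)$ be the continuous extension of $\mathcal B_\circ^*$. A function $U\in L^2(Q)$ is a variational solution of $\partial_tU+CU=F$, $U(0,\cdot)=\bar U$, if $$\iint_Q U\,\mathcal B^*V\,dx\,dt=\iint_Q FV\,dx\,dt+\int_D\bar U V_0\,dx\qquad\text{for all }V\in\mathcal Y,$$ where $V_0\in L^2(D)$ is the trace of $V$ on $\{0\}\times D$. *Flow-solutions.* Let $X$ be a forward untangled flow of $b$, and let $c\in L^\infty(\bar Q,\sigma)$ with $c\ge0$ $\sigma$-a.e.,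 $f\in L^2(\bar Q,\sigma)$, $\bar u\in L^2(D)$. A function $u\in L^2(\bar Q,\sigma)$ is a flow-solution of $$\partial_tu+b\cdot\nabla u+cu=f\ \text{ in }\bar Q,\qquad u(0,\cdot)=\bar u\ \text{ in }D,\tag{1}$$ if there is a variational solution $U\in L^2(Q)$ for the data $C(t,x)=c(t,X(t,x))$, $F(t,x)=f(t,X(t,x))$, $\bar U=\bar u$ (a *generator* of $u$) such that $$\iint_{\bar Q}u(t,z)\varphi(t,z)\,\varrho(t,dz)\,dt=\iint_QU(t,x)\varphi(t,X(t,x))\,dx\,dt\qquad\text{for all }\varphi\in C(\bar Q).\tag{2}$$ **Theorem.** For $n\in\mathbb{N}$ let $b_n\in L^\infty(\bar Q;\mathbb{R}^d)$ be velocities with forward untangled flows $X_n$ and associated measures $\sigma_n$, let $c_n\in L^\infty(\bar Q,\sigma_n)$ with $c_n\ge0$ $\sigma_n$-a.e., $f_n\in L^2(\bar Q,\sigma_n)$, $\bar u_n\in L^2(D)$, and let $u_n\in L^2(\bar Q,\sigma_n)$ be flow-solutions of (1) for the data $b_n,X_n,c_n,f_n,\bar u_n$, with generators $U_n\in L^2(Q)$.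 Put $C_n(t,x)=c_n(t,X_n(t,x))$ and $F_n(t,x)=f_n(t,X_n(t,x))$. Assume that $\sup_n\|c_n\|_{L^\infty(\bar Q,\sigma_n)}<\infty$ and that 1. there are $b\in L^\infty(\bar Q;\mathbb{R}^d)$ and a forward untangled flow $X$ of $b$ such that $b_n\to b$ and $X_n\to X$ pointwise a.e. in $\bar Q$; 2. there is $\bar u\in L^2(D)$ with $\bar u_n\rightharpoonup\bar u$ weakly in $L^2(D)$; 3. there are $c\in L^\infty(\bar Q,\sigma)$ and $f\in L^2(\bar Q,\sigma)$, with $\sigma$ the measure associated with $X$, such that, with $C(t,x)=c(t,X(t,x))$ and $F(t,x)=f(t,X(t,x))$, we have $C_n\to C$ pointwise a.e. in $Q$ and $F_n\rightharpoonup F$ weakly in $L^2(Q)$. Then there are a subsequence (not relabeled) and $U\in L^2(Q)$ with $U_n\rightharpoonup U$ weakly in $L^2(Q)$ such that (2) defines a function $u\in L^2(\bar Q,\sigma)$ (it exists and is unique up to $\sigma$-null sets), and $u$ is a flow-solution of (1) for the data $b,X,c,f,\bar u$ (in particular $c\ge 0$ $\sigma$-a.e.), with generator $U$. -/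

import Mathlib

open MeasureTheory Set Filter Topology
open scoped ENNReal NNReal

noncomputable section

namespace FlowTransport

/-- Euclidean space `ℝ^d`. -/
abbrev Space (d : ℕ) : Type := EuclideanSpace ℝ (Fin d)

/-- A bounded Lipschitz domain: a nonempty, bounded, open and connected set which, in a neighbourhood
of each of its boundary points `p`, is the region above the graph of a Lipschitz function `g` of the
projection `y - ⟪e, y⟫ e` of `y` to the hyperplane orthogonal to some unit vector `e`. -/
structure IsBoundedLipschitzDomain {d : ℕ} (D : Set (Space d)) : Prop where
  isOpen : IsOpen D
  isConnected : IsConnected D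
  isBounded : Bornology.IsBounded D
  locally_graph : ∀ p ∈ frontier D, ∃ (e : Space d) (g : Space d → ℝ) (K : ℝ≥0) (r : ℝ),
    ‖e‖ = 1 ∧ LipschitzWith K g ∧ 0 < r ∧
      ∀ y ∈ Metric.ball p r, (y ∈ D ↔ g (y - inner ℝ e y • e) < inner ℝ e y)

/-- The open space-time cylinder `Q = (0,T) × D`. -/
def spaceTimeCylinder {d : ℕ} (T : ℝ) (D : Set (Space d)) : Set (ℝ × Space d) := Ioo 0 T ×ˢ D

/-- The closed space-time cylinder `Q̄ = [0,T] × D̄`. -/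
def closedSpaceTimeCylinder {d : ℕ} (T : ℝ) (D : Set (Space d)) : Set (ℝ × Space d) :=
  Icc 0 T ×ˢ closure D

/-! ### Filippov solutions and forward untangled flows -/

/-- The essential supporting function
`h(t,x,ξ) = lim_{δ → 0} ess sup_{y ∈ B_δ(x) ∩ Ω} ξ · b(t,y)`, with values in `[-∞,∞]`.
The essential supremum is monotone in `δ`, so that the limit is the infimum over `δ > 0`. -/
def filippovSupport {d : ℕ} (Ω : Set (Space d)) (b : ℝ × Space d → Space d)
    (t : ℝ) (x ξ : Space d) : EReal :=
  ⨅ (δ : ℝ) (_ : 0 < δ),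
    essSup (fun y => ((inner ℝ ξ (b (t, y)) : ℝ) : EReal)) (volume.restrict (Metric.ball x δ ∩ Ω))

/-- The Filippov set-valued map
`F(t,x) = ⋂_{|ξ| = 1} {v : ξ · v ≤ h(t,x,ξ)}` of the velocity `b` on `Ω`. -/
def filippovMap {d : ℕ} (Ω : Set (Space d)) (b : ℝ × Space d → Space d)
    (t : ℝ) (x : Space d) : Set (Space d) :=
  {v | ∀ ξ : Space d, ‖ξ‖ = 1 → ((inner ℝ ξ v : ℝ) : EReal) ≤ filippovSupport Ω b t x ξ}

/-- `γ : [0,T] → Ω` is a Filippov solution of `γ' = b(t,γ)`, `γ(0) = x`: an absolutely continuous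
curve in `Ω` with `γ'(t) ∈ F(t,γ(t))` for almost every `t ∈ [0,T]`. -/
structure IsFilippovSolution {d : ℕ} (T : ℝ) (Ω : Set (Space d)) (b : ℝ × Space d → Space d)
    (x : Space d) (γ : ℝ → Space d) : Prop where
  mapsTo : ∀ t ∈ Icc 0 T, γ t ∈ Ω
  initial : γ 0 = x
  absolutelyContinuous : AbsolutelyContinuousOnInterval γ 0 T
  inclusion : ∀ᵐ t ∂volume.restrict (Icc 0 T), ∃ v ∈ filippovMap Ω b t (γ t), HasDerivAt γ v t

/-- `X : Q̄ → D̄` is a forward untangled flow of the velocity `b ∈ L^∞(Q̄; ℝ^d)`. -/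
structure IsUntangledFlow {d : ℕ} (T : ℝ) (D : Set (Space d)) (b : ℝ × Space d → Space d)
    (X : ℝ → Space d → Space d) : Prop where
  velocity : MemLp b ∞ (volume.restrict (closedSpaceTimeCylinder T D))
  measurable : ∀ t ∈ Icc 0 T, Measurable fun x : closure D => X t x
  filippov : ∀ x ∈ closure D, IsFilippovSolution T (closure D) b x fun t => X t x
  untangled : ∀ s ∈ Icc 0 T, ∀ x₁ ∈ closure D, ∀ x₂ ∈ closure D,
    X s x₁ = X s x₂ → ∀ t ∈ Icc s T, X t x₁ = X t x₂

/-- The density `ϱ(t,·) = X(t,·) # (ℒ^d ⌞ D)`. -/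
def flowDensity {d : ℕ} (D : Set (Space d)) (X : ℝ → Space d → Space d) (t : ℝ) :
    Measure (Space d) :=
  (volume.restrict D).map (X t)

/-- The space-time measure `σ(dz,dt) = ϱ(t,dz) dt` on `[0,T] × D̄`. -/
def spaceTimeMeasure {d : ℕ} (T : ℝ) (D : Set (Space d)) (X : ℝ → Space d → Space d) :
    Measure (ℝ × Space d) :=
  (volume.restrict (Icc 0 T)).bind fun t => (flowDensity D X t).map fun z => (t, z)

/-- The function `(t,x) ↦ g(t, X(t,x))`. -/
def alongFlow {d : ℕ} (X : ℝ → Space d → Space d) (g : ℝ × Space d → ℝ) :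
    ℝ × Space d → ℝ :=
  fun p => g (p.1, X p.1 p.2)

/-! ### The variational formulation of `∂ₜU + CU = F`, `U(0,·) = Ū` -/

/-- The formal adjoint `B₀* V = -∂ₜV + CV`. -/
def formalAdjoint {d : ℕ} (C V : ℝ × Space d → ℝ) : ℝ × Space d → ℝ :=
  fun p => -deriv (fun s => V (s, p.2)) p.1 + C p * V p

/-- `V ∈ C(Q̄) ∩ C¹(Q)` with `V(T,·) = 0` and with finite graph norm `‖B₀* V‖_{L²(Q)}`. -/
structure IsSmoothTest {d : ℕ} (T : ℝ) (D : Set (Space d)) (C V : ℝ × Space d → ℝ) : Prop where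
  continuousOn : ContinuousOn V (closedSpaceTimeCylinder T D)
  contDiffOn : ContDiffOn ℝ 1 V (spaceTimeCylinder T D)
  final : ∀ x ∈ closure D, V (T, x) = 0
  memLp : MemLp (formalAdjoint C V) 2 (volume.restrict (spaceTimeCylinder T D))

/-- `V` belongs to the test space `𝒴`, the closure of the smooth test functions with respect to the
graph norm `‖V‖ = ‖B₀* V‖_{L²(Q)}`, the continuous extension `B*` of `B₀*` takes the value `W` at `V`,
and `V₀` is the strong `L²(D)`-trace of `V` on `{0} × D`. On the smooth test functions the graph norm
controls the `L²(Q)`-norm and the `L²(D)`-norm of the trace, so that the closure is realized in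
`L²(Q)`, with `W` and `V₀` the limits of `B₀* Vₖ` and `Vₖ(0,·)` for smooth `Vₖ → V`. -/
def IsTestFunction {d : ℕ} (T : ℝ) (D : Set (Space d)) (C V W : ℝ × Space d → ℝ)
    (V₀ : Space d → ℝ) : Prop :=
  MemLp V 2 (volume.restrict (spaceTimeCylinder T D)) ∧ MemLp W 2 (volume.restrict (spaceTimeCylinder T D)) ∧
  MemLp V₀ 2 (volume.restrict D) ∧
  ∃ Vk : ℕ → ℝ × Space d → ℝ, (∀ k, IsSmoothTest T D C (Vk k)) ∧
    Tendsto (fun k => eLpNorm (fun p => Vk k p - V p) 2 (volume.restrict (spaceTimeCylinder T D)))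
      atTop (𝓝 0) ∧
    Tendsto (fun k => eLpNorm (fun p => formalAdjoint C (Vk k) p - W p) 2
      (volume.restrict (spaceTimeCylinder T D))) atTop (𝓝 0) ∧
    Tendsto (fun k => eLpNorm (fun x => Vk k (0, x) - V₀ x) 2 (volume.restrict D)) atTop (𝓝 0)

/-- `U ∈ L²(Q)` is a variational solution of `∂ₜU + CU = F`, `U(0,·) = Ū`: for all `V ∈ 𝒴`,
`⟨U, B* V⟩_{L²(Q)} = ⟨F, V⟩_{L²(Q)} + ∫_D Ū V₀ dx`. -/
def IsVariationalSolution {d : ℕ} (T : ℝ) (D : Set (Space d)) (C F : ℝ × Space d → ℝ)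
    (Ubar : Space d → ℝ) (U : ℝ × Space d → ℝ) : Prop :=
  MemLp U 2 (volume.restrict (spaceTimeCylinder T D)) ∧
  ∀ (V W : ℝ × Space d → ℝ) (V₀ : Space d → ℝ), IsTestFunction T D C V W V₀ →
    ∫ p in spaceTimeCylinder T D, U p * W p =
      (∫ p in spaceTimeCylinder T D, F p * V p) + ∫ x in D, Ubar x * V₀ x

/-! ### Flow-solutions -/

/-- The data of the transport problem: `c ∈ L^∞(Q̄,σ)` with `c ≥ 0` `σ`-a.e., `f ∈ L²(Q̄,σ)` and
`ū ∈ L²(D)`. -/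
structure IsTransportData {d : ℕ} (T : ℝ) (D : Set (Space d)) (X : ℝ → Space d → Space d)
    (c f : ℝ × Space d → ℝ) (ubar : Space d → ℝ) : Prop where
  memLp_c : MemLp c ∞ (spaceTimeMeasure T D X)
  nonneg_c : ∀ᵐ p ∂spaceTimeMeasure T D X, 0 ≤ c p
  memLp_f : MemLp f 2 (spaceTimeMeasure T D X)
  memLp_ubar : MemLp ubar 2 (volume.restrict D)

/-- `u` is induced by `U` through the flow: for all `φ ∈ C(Q̄)`,
`∬_{Q̄} u(t,z) φ(t,z) ϱ(t,dz) dt = ∬_Q U(t,x) φ(t,X(t,x)) dx dt`. -/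
def IsInducedBy {d : ℕ} (T : ℝ) (D : Set (Space d)) (X : ℝ → Space d → Space d)
    (u U : ℝ × Space d → ℝ) : Prop :=
  ∀ φ : ℝ × Space d → ℝ, ContinuousOn φ (closedSpaceTimeCylinder T D) →
    ∫ p, u p * φ p ∂spaceTimeMeasure T D X =
      ∫ p in spaceTimeCylinder T D, U p * alongFlow X φ p

/-- `U` is a generator of `u` for the transport problem with data `c, f, ū`: it is a variational
solution for the coefficients `c(t,X(t,x))`, `f(t,X(t,x))`, `ū(x)`, and it induces `u`. -/
def IsGenerator {d : ℕ} (T : ℝ) (D : Set (Space d)) (X : ℝ → Space d → Space d)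
    (c f : ℝ × Space d → ℝ) (ubar : Space d → ℝ) (u U : ℝ × Space d → ℝ) : Prop :=
  IsVariationalSolution T D (alongFlow X c) (alongFlow X f) ubar U ∧ IsInducedBy T D X u U

/-- `u` is a flow-solution of `∂ₜu + b·∇u + cu = f` in `Q̄`, `u(0,·) = ū` in `D`, for the velocity `b`
with the chosen forward untangled flow `X`. -/
structure IsFlowSolution {d : ℕ} (T : ℝ) (D : Set (Space d)) (b : ℝ × Space d → Space d)
    (X : ℝ → Space d → Space d) (c f : ℝ × Space d → ℝ) (ubar : Space d → ℝ)
    (u : ℝ × Space d → ℝ) : Prop where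
  flow : IsUntangledFlow T D b X
  data : IsTransportData T D X c f ubar
  memLp : MemLp u 2 (spaceTimeMeasure T D X)
  exists_generator : ∃ U : ℝ × Space d → ℝ, IsGenerator T D X c f ubar u U

/-- Weak convergence `gₙ ⇀ g` in the real Hilbert space `L²(μ)`. -/
def WeakL2Tendsto {α : Type*} [MeasurableSpace α] (μ : Measure α) (g : ℕ → α → ℝ) (g' : α → ℝ) :
    Prop :=
  (∀ n, MemLp (g n) 2 μ) ∧ MemLp g' 2 μ ∧
  ∀ h : α → ℝ, MemLp h 2 μ → Tendsto (fun n => ∫ a, g n a * h a ∂μ) atTop (𝓝 (∫ a, g' a * h a ∂μ))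

end FlowTransport

end

open FlowTransport

/-! Along a flow the transport equation becomes the linear equation `∂ₜU + CU = F` on `Q`, with `x`
as a mere parameter, and `σ` is the image of Lebesgue measure on `Q` under `(t,x) ↦ (t, X(t,x))`
(`IsUntangledFlow.exists_map_eq`). The limit is therefore taken for the generators, on the fixed
domain `Q`.

Compactness comes from an a priori `L²` bound (`IsVariationalSolution.exists_bound`): the time
primitive `V(t,x) = ∫_t^T e^{-2λs} U(s,x) ds` is an admissible test function, and for large `λ` the
term with `C` is absorbed into the square of the weighted norm of `U`. Bounded sequences in `L²`
have weakly convergent subsequences.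

For the limit equation it suffices to test with smooth `V` (`isVariationalSolution_of_smooth`). Each
such `V` is admissible for all the bounded coefficients at once, and `(Cₙ - C)V → 0` strongly in
`L²(Q)` by dominated convergence; what remains are pairings of weakly with strongly convergent
sequences.

Finally, composition with `(t,x) ↦ (t, X(t,x))` is an isometry from `L²(σ)` into `L²(Q)`, and its
adjoint maps the limit generator to the induced function `u`. -/

namespace FlowTransport

/-! ### Weak convergence in `L²`. -/

section L2
variable {α : Type*} [MeasurableSpace α] {μ : Measure α}

theorem inner_toLp_eq_integral {f g : α → ℝ} (hf : MemLp f 2 μ) (hg : MemLp g 2 μ) :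
    inner ℝ (hf.toLp f) (hg.toLp g) = ∫ a, f a * g a ∂μ := by
  rw [L2.inner_def]
  refine integral_congr_ae ?_
  filter_upwards [hf.coeFn_toLp, hg.coeFn_toLp] with a ha hb
  rw [ha, hb]
  simp [mul_comm]

theorem abs_integral_mul_le {f g : α → ℝ} (hf : MemLp f 2 μ) (hg : MemLp g 2 μ) :
    |∫ a, f a * g a ∂μ| ≤ (eLpNorm f 2 μ).toReal * (eLpNorm g 2 μ).toReal := by
  rw [← inner_toLp_eq_integral hf hg, ← Lp.norm_toLp f hf, ← Lp.norm_toLp g hg]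
  exact abs_real_inner_le_norm _ _

theorem integral_mul_self_eq {f : α → ℝ} (hf : MemLp f 2 μ) :
    ∫ a, f a * f a ∂μ = (eLpNorm f 2 μ).toReal ^ 2 := by
  rw [← inner_toLp_eq_integral hf hf, ← Lp.norm_toLp f hf, real_inner_self_eq_norm_sq]

theorem integrable_mul_of_memLp_two {f g : α → ℝ} (hf : MemLp f 2 μ) (hg : MemLp g 2 μ) :
    Integrable (fun a => f a * g a) μ :=
  hf.integrable_mul hg

/-- Weakly convergent sequences in `L²` are bounded. -/
theorem WeakL2Tendsto.exists_bound {g : ℕ → α → ℝ} {g' : α → ℝ} (h : WeakL2Tendsto μ g g') :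
    ∃ K : ℝ, ∀ n, (eLpNorm (g n) 2 μ).toReal ≤ K := by
  obtain ⟨hg, -, hlim⟩ := h
  -- Uniform boundedness for the functionals `⟨gₙ, ·⟩`: on each vector they form a convergent, hence
  -- bounded, sequence.
  have hb : ∀ x : Lp ℝ 2 μ, ∃ K, ∀ n, ‖innerSL ℝ ((hg n).toLp (g n)) x‖ ≤ K := by
    intro x
    have h1 := hlim x (Lp.memLp x)
    obtain ⟨K, hK⟩ := (Metric.isBounded_range_of_tendsto _ h1).exists_norm_le
    refine ⟨K, fun n => ?_⟩
    have h2 := inner_toLp_eq_integral (hg n) (Lp.memLp x)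
    rw [Lp.toLp_coeFn] at h2
    rw [innerSL_apply_apply, h2]
    exact hK _ ⟨n, rfl⟩
  obtain ⟨K, hK⟩ := banach_steinhaus hb
  refine ⟨K, fun n => ?_⟩
  have := hK n
  rwa [innerSL_apply_norm, Lp.norm_toLp] at this

theorem weakL2Tendsto_const {f : α → ℝ} (hf : MemLp f 2 μ) : WeakL2Tendsto μ (fun _ => f) f :=
  ⟨fun _ => hf, hf, fun _ _ => tendsto_const_nhds⟩

/-- The pairing of a weakly and a strongly convergent sequence converges. -/
theorem WeakL2Tendsto.tendsto_integral_mul {f g : ℕ → α → ℝ} {f' g' : α → ℝ}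
    (hf : WeakL2Tendsto μ f f') (hg : ∀ n, MemLp (g n) 2 μ) (hg' : MemLp g' 2 μ)
    (h : Tendsto (fun n => eLpNorm (fun a => g n a - g' a) 2 μ) atTop (𝓝 0)) :
    Tendsto (fun n => ∫ a, f n a * g n a ∂μ) atTop (𝓝 (∫ a, f' a * g' a ∂μ)) := by
  obtain ⟨K, hK⟩ := hf.exists_bound
  have h1 : Tendsto (fun n => ∫ a, f n a * (g n a - g' a) ∂μ) atTop (𝓝 0) := by
    have h2 : Tendsto (fun n => K * (eLpNorm (fun a => g n a - g' a) 2 μ).toReal) atTop (𝓝 0) := by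
      simpa using ((ENNReal.tendsto_toReal ENNReal.zero_ne_top).comp h).const_mul K
    refine squeeze_zero_norm (fun n => ?_) h2
    exact (abs_integral_mul_le (hf.1 n) ((hg n).sub hg')).trans
      (mul_le_mul_of_nonneg_right (hK n) ENNReal.toReal_nonneg)
  have h3 := (hf.2.2 g' hg').add h1
  rw [add_zero] at h3
  refine h3.congr fun n => ?_
  have hi : Integrable (fun a => f n a * (g n a - g' a)) μ :=
    integrable_mul_of_memLp_two (hf.1 n) ((hg n).sub hg')
  rw [← integral_add (integrable_mul_of_memLp_two (hf.1 n) hg') hi]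
  exact integral_congr_ae (.of_forall fun a => by simp only; ring)

/-- Bounded sequences in `L²` have weakly convergent subsequences. -/
theorem exists_weakL2Tendsto_subseq [MeasurableSpace.CountablyGenerated α] [SigmaFinite μ]
    {g : ℕ → α → ℝ} (hg : ∀ n, MemLp (g n) 2 μ) {K : ℝ}
    (hK : ∀ n, (eLpNorm (g n) 2 μ).toReal ≤ K) :
    ∃ (k : ℕ → ℕ) (g' : α → ℝ), StrictMono k ∧ WeakL2Tendsto μ (fun j => g (k j)) g' := by
  have : Fact ((2 : ℝ≥0∞) ≠ ∞) := ⟨by norm_num⟩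
  -- The Riesz functionals lie in a ball of the dual, which is weak-* sequentially compact because
  -- `L²(μ)` is separable; this is where countable generation and σ-finiteness enter.
  let L : ℕ → WeakDual ℝ (Lp ℝ 2 μ) := fun n =>
    StrongDual.toWeakDual (InnerProductSpace.toDual ℝ _ ((hg n).toLp (g n)))
  have hL : ∀ n, L n ∈ WeakDual.toStrongDual ⁻¹'
      Metric.closedBall (0 : StrongDual ℝ (Lp ℝ 2 μ)) K := by
    intro n
    have : ‖InnerProductSpace.toDual ℝ _ ((hg n).toLp (g n))‖ ≤ K := by
      rw [LinearIsometryEquiv.norm_map, Lp.norm_toLp]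
      exact hK n
    simpa [L] using this
  obtain ⟨a, -, k, hk, hlim⟩ := WeakDual.isSeqCompact_closedBall ℝ (Lp ℝ 2 μ) 0 K hL
  let x := (InnerProductSpace.toDual ℝ (Lp ℝ 2 μ)).symm (WeakDual.toStrongDual a)
  refine ⟨k, x, hk, fun j => hg _, Lp.memLp x, fun h hh => ?_⟩
  have h1 := ((WeakDual.eval_continuous (hh.toLp h)).tendsto a).comp hlim
  have h2 : a (hh.toLp h) = ∫ b, x b * h b ∂μ := by
    rw [← inner_toLp_eq_integral (Lp.memLp x) hh, Lp.toLp_coeFn,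
      InnerProductSpace.toDual_symm_apply]
    rfl
  rw [h2] at h1
  refine h1.congr fun j => ?_
  rw [← inner_toLp_eq_integral (hg (k j)) hh]
  rfl

end L2

/-! ### The space-time measure of a flow as an image measure. -/

variable {d : ℕ} {T : ℝ} {D : Set (Space d)}

/-- Lebesgue measure on the open cylinder. -/
noncomputable abbrev cylinderMeasure (T : ℝ) (D : Set (Space d)) : Measure (ℝ × Space d) :=
  volume.restrict (spaceTimeCylinder T D)

theorem cylinderMeasure_eq_prod (T : ℝ) (D : Set (Space d)) :
    cylinderMeasure T D = (volume.restrict (Ioo 0 T)).prod (volume.restrict D) := by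
  rw [Measure.prod_restrict]; rfl

theorem IsBoundedLipschitzDomain.isFiniteMeasure (hD : IsBoundedLipschitzDomain D) :
    IsFiniteMeasure (volume.restrict D) :=
  ⟨by simpa using hD.isBounded.measure_lt_top⟩

theorem IsBoundedLipschitzDomain.isFiniteMeasure_cylinderMeasure
    (hD : IsBoundedLipschitzDomain D) (T : ℝ) : IsFiniteMeasure (cylinderMeasure T D) := by
  have := hD.isFiniteMeasure
  rw [cylinderMeasure_eq_prod]
  infer_instance

theorem measurableSet_spaceTimeCylinder (hD : IsBoundedLipschitzDomain D) (T : ℝ) :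
    MeasurableSet (spaceTimeCylinder T D) :=
  measurableSet_Ioo.prod hD.isOpen.measurableSet

theorem spaceTimeCylinder_subset_closed (T : ℝ) (D : Set (Space d)) :
    spaceTimeCylinder T D ⊆ closedSpaceTimeCylinder T D :=
  prod_mono Ioo_subset_Icc_self subset_closure

theorem isCompact_closedSpaceTimeCylinder (hD : IsBoundedLipschitzDomain D) (T : ℝ) :
    IsCompact (closedSpaceTimeCylinder T D) :=
  isCompact_Icc.prod hD.isBounded.isCompact_closure

/-- A flow agrees on the closed cylinder with a jointly measurable map. -/
theorem IsUntangledFlow.exists_measurable {b : ℝ × Space d → Space d} {X : ℝ → Space d → Space d}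
    (hT : 0 < T) (h : IsUntangledFlow T D b X) :
    ∃ Y : ℝ × Space d → Space d, Measurable Y ∧
      ∀ t ∈ Icc 0 T, ∀ x ∈ closure D, Y (t, x) = X t x := by
  -- Clamping time to `[0,T]` makes every path continuous on `ℝ`. A map continuous in `t` and
  -- measurable in `x` is jointly measurable; the embedding of `ℝ × D̄` then allows a measurable
  -- extension.
  let Z : ℝ → closure D → Space d := fun t x => X (projIcc 0 T hT.le t) x
  have hZ : Measurable (Function.uncurry Z) := by
    refine measurable_uncurry_of_continuous_of_measurable (fun x => ?_) (fun t => ?_)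
    · have hc := (h.filippov x x.2).absolutelyContinuous.continuousOn
      rw [uIcc_of_le hT.le] at hc
      exact hc.comp_continuous (continuous_subtype_val.comp continuous_projIcc)
        fun t => (projIcc 0 T hT.le t).2
    · exact h.measurable _ (projIcc 0 T hT.le t).2
  have he : MeasurableEmbedding (Prod.map id Subtype.val : ℝ × closure D → ℝ × Space d) :=
    MeasurableEmbedding.id.prodMap (MeasurableEmbedding.subtype_coe isClosed_closure.measurableSet)
  obtain ⟨Y, hY, hYZ⟩ := he.exists_measurable_extend hZ fun _ => ⟨0⟩
  refine ⟨Y, hY, fun t ht x hx => ?_⟩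
  have := congrFun hYZ (t, ⟨x, hx⟩)
  simpa [Z, Function.uncurry, projIcc_of_mem hT.le ht] using this

/-- The space-time measure of a flow is the image of Lebesgue measure under `(t,x) ↦ (t, X(t,x))`. -/
theorem IsUntangledFlow.exists_map_eq {b : ℝ × Space d → Space d} {X : ℝ → Space d → Space d}
    (hT : 0 < T) (hD : IsBoundedLipschitzDomain D) (h : IsUntangledFlow T D b X) :
    ∃ Φ : ℝ × Space d → ℝ × Space d, Measurable Φ ∧
      (∀ p ∈ spaceTimeCylinder T D, Φ p = (p.1, X p.1 p.2)) ∧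
      spaceTimeMeasure T D X = (cylinderMeasure T D).map Φ := by
  obtain ⟨Y, hY, hYX⟩ := h.exists_measurable hT
  have hΦ : Measurable fun p : ℝ × Space d => (p.1, Y p) := measurable_fst.prodMk hY
  have := hD.isFiniteMeasure
  refine ⟨fun p => (p.1, Y p), hΦ, fun p hp => ?_, ?_⟩
  · rw [← hYX p.1 (Ioo_subset_Icc_self hp.1) p.2 (subset_closure hp.2)]
  · have h1 : ∀ t ∈ Icc 0 T, (flowDensity D X t).map (fun z => (t, z)) =
        ((volume.restrict D).map (Prod.mk t)).map fun p : ℝ × Space d => (p.1, Y p) := by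
      intro t ht
      have h2 : X t =ᵐ[volume.restrict D] fun x => Y (t, x) := by
        filter_upwards [ae_restrict_mem hD.isOpen.measurableSet] with x hx
        exact (hYX t ht x (subset_closure hx)).symm
      have h4 : Measurable fun x => Y (t, x) := hY.comp measurable_prodMk_left
      rw [flowDensity, Measure.map_congr h2, Measure.map_map measurable_prodMk_left h4,
        Measure.map_map hΦ measurable_prodMk_left]
      rfl
    have h3 : spaceTimeMeasure T D X = (volume.restrict (Icc 0 T)).bind fun t =>
        ((volume.restrict D).map (Prod.mk t)).map fun p : ℝ × Space d => (p.1, Y p) := by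
      refine Measure.bind_congr_right ?_
      filter_upwards [ae_restrict_mem measurableSet_Icc] with t ht using h1 t ht
    rw [h3, cylinderMeasure_eq_prod, restrict_Ioo_eq_restrict_Icc]
    ext s hs
    have h5 : Measurable fun t : ℝ =>
        ((volume.restrict D).map (Prod.mk t)).map fun p : ℝ × Space d => (p.1, Y p) :=
      (Measure.measurable_map _ hΦ).comp Measurable.map_prodMk_left
    rw [Measure.bind_apply hs h5.aemeasurable, Measure.map_apply hΦ hs, Measure.prod_apply (hΦ hs)]
    refine lintegral_congr fun t => ?_
    rw [Measure.map_apply hΦ hs, Measure.map_apply measurable_prodMk_left (hΦ hs)]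

theorem alongFlow_ae_eq (hD : IsBoundedLipschitzDomain D) {X : ℝ → Space d → Space d}
    {Φ : ℝ × Space d → ℝ × Space d}
    (hΦX : ∀ p ∈ spaceTimeCylinder T D, Φ p = (p.1, X p.1 p.2)) (g : ℝ × Space d → ℝ) :
    alongFlow X g =ᵐ[cylinderMeasure T D] g ∘ Φ := by
  filter_upwards [ae_restrict_mem (measurableSet_spaceTimeCylinder hD T)] with p hp
  simp [alongFlow, hΦX p hp]

theorem IsUntangledFlow.ae_alongFlow {b : ℝ × Space d → Space d} {X : ℝ → Space d → Space d}
    (hT : 0 < T) (hD : IsBoundedLipschitzDomain D) (h : IsUntangledFlow T D b X)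
    {g : ℝ × Space d → ℝ} {P : ℝ → Prop} (hP : ∀ᵐ p ∂spaceTimeMeasure T D X, P (g p)) :
    ∀ᵐ p ∂cylinderMeasure T D, P (alongFlow X g p) := by
  obtain ⟨Φ, hΦ, hΦX, hσ⟩ := h.exists_map_eq hT hD
  rw [hσ] at hP
  filter_upwards [ae_of_ae_map hΦ.aemeasurable hP, alongFlow_ae_eq hD hΦX g] with p hp hp'
  rwa [hp']

theorem IsUntangledFlow.memLp_alongFlow {b : ℝ × Space d → Space d} {X : ℝ → Space d → Space d}
    (hT : 0 < T) (hD : IsBoundedLipschitzDomain D) (h : IsUntangledFlow T D b X)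
    {g : ℝ × Space d → ℝ} {r : ℝ≥0∞} (hg : MemLp g r (spaceTimeMeasure T D X)) :
    MemLp (alongFlow X g) r (cylinderMeasure T D) := by
  obtain ⟨Φ, hΦ, hΦX, hσ⟩ := h.exists_map_eq hT hD
  rw [hσ] at hg
  exact (hg.comp_of_map hΦ.aemeasurable).ae_eq (alongFlow_ae_eq hD hΦX g).symm

theorem IsUntangledFlow.ae_nonneg_of_alongFlow {b : ℝ × Space d → Space d}
    {X : ℝ → Space d → Space d}
    (hT : 0 < T) (hD : IsBoundedLipschitzDomain D) (h : IsUntangledFlow T D b X)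
    {g : ℝ × Space d → ℝ} (hg : AEStronglyMeasurable g (spaceTimeMeasure T D X))
    (h0 : ∀ᵐ p ∂cylinderMeasure T D, 0 ≤ alongFlow X g p) :
    ∀ᵐ p ∂spaceTimeMeasure T D X, 0 ≤ g p := by
  obtain ⟨Φ, hΦ, hΦX, hσ⟩ := h.exists_map_eq hT hD
  rw [hσ] at hg ⊢
  -- Null sets of an image measure are read off on the source only for measurable sets, hence the
  -- passage to a measurable representative.
  have h1 : ∀ᵐ p ∂(cylinderMeasure T D).map Φ, 0 ≤ hg.mk g p := by
    rw [ae_map_iff hΦ.aemeasurable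
      (measurableSet_le measurable_const hg.stronglyMeasurable_mk.measurable)]
    filter_upwards [ae_of_ae_map hΦ.aemeasurable hg.ae_eq_mk, h0, alongFlow_ae_eq hD hΦX g]
      with p hp1 hp2 hp3
    rw [← hp1]
    rwa [hp3] at hp2
  filter_upwards [h1, hg.ae_eq_mk] with p hp1 hp2
  rwa [hp2]

theorem IsUntangledFlow.isFiniteMeasure_spaceTimeMeasure {b : ℝ × Space d → Space d}
    {X : ℝ → Space d → Space d}
    (hT : 0 < T) (hD : IsBoundedLipschitzDomain D) (h : IsUntangledFlow T D b X) :
    IsFiniteMeasure (spaceTimeMeasure T D X) := by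
  obtain ⟨Φ, hΦ, -, hσ⟩ := h.exists_map_eq hT hD
  have := hD.isFiniteMeasure_cylinderMeasure T
  rw [hσ]
  infer_instance

/-- Paths stay in `D̄`. This makes a `φ` that is continuous only on `Q̄` measurable and bounded
`σ`-a.e. -/
theorem IsUntangledFlow.ae_mem_closedSpaceTimeCylinder {b : ℝ × Space d → Space d}
    {X : ℝ → Space d → Space d}
    (hT : 0 < T) (hD : IsBoundedLipschitzDomain D) (h : IsUntangledFlow T D b X) :
    ∀ᵐ p ∂spaceTimeMeasure T D X, p ∈ closedSpaceTimeCylinder T D := by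
  obtain ⟨Φ, hΦ, hΦX, hσ⟩ := h.exists_map_eq hT hD
  have hm : MeasurableSet {p | p ∈ closedSpaceTimeCylinder T D} :=
    (isCompact_closedSpaceTimeCylinder hD T).measurableSet
  rw [hσ, ae_map_iff hΦ.aemeasurable hm]
  filter_upwards [ae_restrict_mem (measurableSet_spaceTimeCylinder hD T)] with p hp
  have ht : p.1 ∈ Icc 0 T := Ioo_subset_Icc_self hp.1
  rw [hΦX p hp]
  exact ⟨ht, (h.filippov p.2 (subset_closure hp.2)).mapsTo p.1 ht⟩

/-! ### Integral operators in time and the terminal primitive. -/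

theorem eLpNorm_two_sq {α : Type*} [MeasurableSpace α] (μ : Measure α) (f : α → ℝ) :
    eLpNorm f 2 μ ^ 2 = ∫⁻ a, ‖f a‖ₑ ^ 2 ∂μ := by
  have := eLpNorm_nnreal_pow_eq_lintegral (f := f) (μ := μ) (p := 2) (by norm_num)
  have h2 : ((2 : ℝ≥0) : ℝ) = ((2 : ℕ) : ℝ) := by norm_num
  simp only [h2, ENNReal.rpow_natCast] at this
  exact this

/-- Cauchy–Schwarz for an integral operator acting on the first variable, at one output value. -/
theorem enorm_integral_mul_sq_le {α : Type*} [MeasurableSpace α] {ν : Measure α}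
    {k w : α → ℝ} (hk : AEMeasurable k ν) (hw : AEMeasurable w ν) :
    ‖∫ s, k s * w s ∂ν‖ₑ ^ 2 ≤ (∫⁻ s, ‖k s‖ₑ ^ 2 ∂ν) * ∫⁻ s, ‖w s‖ₑ ^ 2 ∂ν := by
  have h1 : ‖∫ s, k s * w s ∂ν‖ₑ ≤ ∫⁻ s, ‖k s‖ₑ * ‖w s‖ₑ ∂ν := by
    simpa [enorm_mul] using enorm_integral_le_lintegral_enorm (μ := ν) fun s => k s * w s
  have h2 := ENNReal.lintegral_mul_le_Lp_mul_Lq ν Real.HolderConjugate.two_two hk.enorm hw.enorm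
  have h3 : ∀ a : ℝ≥0∞, (a ^ (1 / 2 : ℝ)) ^ 2 = a := fun a => by
    rw [← ENNReal.rpow_natCast, ← ENNReal.rpow_mul]; norm_num
  calc _ ≤ _ := pow_le_pow_left₀ zero_le (h1.trans h2) 2
    _ = _ := by rw [mul_pow, h3, h3]; norm_cast

theorem lintegral_enorm_integral_mul_sq_le {α β : Type*} [MeasurableSpace α] [MeasurableSpace β]
    {ν : Measure α} {ρ : Measure β} [SFinite ν] [SFinite ρ] {k : α → ℝ} {w : α × β → ℝ}
    (hk : AEMeasurable k ν) (hw : Measurable w) {A : ℝ≥0∞} (hA : ∫⁻ s, ‖k s‖ₑ ^ 2 ∂ν ≤ A) :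
    ∫⁻ x, ‖∫ s, k s * w (s, x) ∂ν‖ₑ ^ 2 ∂ρ ≤ A * ∫⁻ p, ‖w p‖ₑ ^ 2 ∂(ν.prod ρ) := by
  have hm : Measurable fun p => ‖w p‖ₑ ^ 2 := hw.enorm.pow_const 2
  calc _ ≤ ∫⁻ x, A * ∫⁻ s, ‖w (s, x)‖ₑ ^ 2 ∂ν ∂ρ := lintegral_mono fun x =>
        (enorm_integral_mul_sq_le hk (hw.comp measurable_prodMk_right).aemeasurable).trans
          (mul_le_mul_left hA _)
    _ = _ := by
      rw [lintegral_const_mul _ hm.lintegral_prod_left', lintegral_prod_symm _ hm.aemeasurable]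

/-- A Hilbert–Schmidt type bound: Cauchy–Schwarz in `s` for each output time, then integration over
that time. The inequality `lintegral_prod_le` needs no joint measurability of `k`. -/
theorem lintegral_prod_enorm_integral_mul_sq_le {α β : Type*} [MeasurableSpace α]
    [MeasurableSpace β] {ν : Measure α} {ρ : Measure β} [SFinite ν] [SFinite ρ]
    {k : α → α → ℝ} {w : α × β → ℝ} (hk : ∀ t, AEMeasurable (k t) ν) (hw : Measurable w)
    {A : ℝ≥0∞} (hA : ∀ t, ∫⁻ s, ‖k t s‖ₑ ^ 2 ∂ν ≤ A) :
    ∫⁻ p, ‖∫ s, k p.1 s * w (s, p.2) ∂ν‖ₑ ^ 2 ∂(ν.prod ρ) ≤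
      ν univ * (A * ∫⁻ p, ‖w p‖ₑ ^ 2 ∂(ν.prod ρ)) := by
  refine (lintegral_prod_le _).trans ?_
  calc _ ≤ ∫⁻ _, A * ∫⁻ p, ‖w p‖ₑ ^ 2 ∂(ν.prod ρ) ∂ν := lintegral_mono fun t =>
        lintegral_enorm_integral_mul_sq_le (hk t) hw (hA t)
    _ = _ := by rw [lintegral_const, mul_comm]

/-- The primitive `(t,x) ↦ ∫_t^T G(s,x) ds` in time, vanishing at the final time. -/
noncomputable def terminalPrimitive (T : ℝ) (G : ℝ × Space d → ℝ) : ℝ × Space d → ℝ :=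
  -- The fixed domain with an indicator kernel puts the primitive within reach of the kernel bounds.
  fun p => ∫ s in Ioo 0 T, (Ioi p.1).indicator 1 s * G (s, p.2)

theorem measurable_terminalPrimitive {G : ℝ × Space d → ℝ} (hG : Measurable G) :
    Measurable (terminalPrimitive T G) := by
  have : Measurable fun q : (ℝ × Space d) × ℝ =>
      (Ioi q.1.1).indicator (1 : ℝ → ℝ) q.2 * G (q.2, q.1.2) := by
    refine Measurable.mul ?_ (by fun_prop)
    have : (fun q : (ℝ × Space d) × ℝ => (Ioi q.1.1).indicator (1 : ℝ → ℝ) q.2) =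
        {q : (ℝ × Space d) × ℝ | q.1.1 < q.2}.indicator 1 := by
      ext q; simp [indicator]
    rw [this]
    exact measurable_one.indicator (measurableSet_lt (by fun_prop) (by fun_prop))
  exact this.stronglyMeasurable.integral_prod_right'.measurable

theorem lintegral_indicator_sq_le (t : ℝ) :
    ∫⁻ s in Ioo 0 T, ‖(Ioi t).indicator (1 : ℝ → ℝ) s‖ₑ ^ 2 ≤ ENNReal.ofReal T := by
  calc _ ≤ ∫⁻ s in Ioo 0 T, 1 := lintegral_mono fun s => by
        by_cases h : t < s <;> simp [indicator, h]
    _ = _ := by simp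

theorem eLpNorm_terminalPrimitive_le {G : ℝ × Space d → ℝ} (hG : Measurable G) :
    eLpNorm (terminalPrimitive T G) 2 (cylinderMeasure T D) ≤
      ENNReal.ofReal T * eLpNorm G 2 (cylinderMeasure T D) := by
  rw [← ENNReal.pow_le_pow_left_iff two_ne_zero, mul_pow, eLpNorm_two_sq, eLpNorm_two_sq,
    cylinderMeasure_eq_prod]
  refine (lintegral_prod_enorm_integral_mul_sq_le (A := ENNReal.ofReal T)
    (fun t => (measurable_one.indicator measurableSet_Ioi).aemeasurable) hG
    fun t => lintegral_indicator_sq_le t).trans_eq ?_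
  simp [sq, mul_assoc]

/-- At a fixed time only the kernel bound `T` enters the squared estimate, whence `√T`; over `Q` the
length of the time interval contributes a second factor `T`. -/
theorem eLpNorm_terminalPrimitive_zero_le {G : ℝ × Space d → ℝ} (hG : Measurable G) :
    eLpNorm (fun x => terminalPrimitive T G (0, x)) 2 (volume.restrict D) ≤
      ENNReal.ofReal T ^ (1 / 2 : ℝ) * eLpNorm G 2 (cylinderMeasure T D) := by
  rw [← ENNReal.pow_le_pow_left_iff two_ne_zero, mul_pow, eLpNorm_two_sq, eLpNorm_two_sq,
    cylinderMeasure_eq_prod, ← ENNReal.rpow_natCast (_ ^ _), ← ENNReal.rpow_mul]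
  simpa [terminalPrimitive] using lintegral_enorm_integral_mul_sq_le (ρ := volume.restrict D)
    (measurable_one.indicator measurableSet_Ioi).aemeasurable hG (lintegral_indicator_sq_le (T := T) 0)

theorem memLp_terminalPrimitive {G : ℝ × Space d → ℝ} (hG : Measurable G)
    (hG2 : MemLp G 2 (cylinderMeasure T D)) :
    MemLp (terminalPrimitive T G) 2 (cylinderMeasure T D) :=
  ⟨(measurable_terminalPrimitive hG).aestronglyMeasurable,
    (eLpNorm_terminalPrimitive_le hG).trans_lt (ENNReal.mul_lt_top ENNReal.ofReal_lt_top hG2.2)⟩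

theorem memLp_terminalPrimitive_zero {G : ℝ × Space d → ℝ} (hG : Measurable G)
    (hG2 : MemLp G 2 (cylinderMeasure T D)) :
    MemLp (fun x => terminalPrimitive T G (0, x)) 2 (volume.restrict D) :=
  ⟨((measurable_terminalPrimitive hG).comp measurable_prodMk_left).aestronglyMeasurable,
    (eLpNorm_terminalPrimitive_zero_le hG).trans_lt
      (ENNReal.mul_lt_top (ENNReal.rpow_lt_top_of_nonneg (by norm_num) ENNReal.ofReal_ne_top) hG2.2)⟩

/-- The exceptional set of `x`, where a time slice fails to be integrable, does not depend on `t`;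
so linearity holds both a.e. in `Q` and for the trace at `t = 0`. -/
theorem terminalPrimitive_sub_ae [IsFiniteMeasure (volume.restrict D)] {G H : ℝ × Space d → ℝ}
    (hG : MemLp G 2 (cylinderMeasure T D)) (hH : MemLp H 2 (cylinderMeasure T D)) :
    ∀ᵐ x ∂volume.restrict D, ∀ t,
      terminalPrimitive T (fun p => G p - H p) (t, x) =
        terminalPrimitive T G (t, x) - terminalPrimitive T H (t, x) := by
  rw [cylinderMeasure_eq_prod] at hG hH
  filter_upwards [(hG.integrable one_le_two).prod_left_ae,
    (hH.integrable one_le_two).prod_left_ae] with x hx hx' t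
  have hi : ∀ {g : ℝ → ℝ}, Integrable g (volume.restrict (Ioo 0 T)) →
      Integrable (fun s => (Ioi t).indicator (1 : ℝ → ℝ) s * g s) (volume.restrict (Ioo 0 T)) :=
    fun {g} hg => (hg.indicator (measurableSet_Ioi (a := t))).congr (.of_forall fun s => by
      by_cases h : t < s <;> simp [indicator, h])
  simp only [terminalPrimitive, mul_sub]
  exact integral_sub (hi hx) (hi hx')

theorem terminalPrimitive_of_le {G : ℝ × Space d → ℝ} {t : ℝ} (ht : t ∈ Icc 0 T) (x : Space d) :
    terminalPrimitive T G (t, x) = ∫ s in t..T, G (s, x) := by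
  rw [intervalIntegral.integral_of_le ht.2, integral_Ioc_eq_integral_Ioo]
  have : (fun s => (Ioi t).indicator (1 : ℝ → ℝ) s * G (s, x)) =
      (Ioi t).indicator fun s => G (s, x) := by
    ext s; by_cases h : t < s <;> simp [indicator, h]
  rw [terminalPrimitive]
  dsimp only
  rw [this, setIntegral_indicator measurableSet_Ioi]
  congr 2
  ext s
  simp only [mem_inter_iff, mem_Ioo, mem_Ioi]
  exact ⟨fun h => ⟨h.2, h.1.2⟩, fun h => ⟨⟨ht.1.trans_lt h.1, h.2⟩, h.1⟩⟩

/-! ### Terminal primitives as test functions. -/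

/-- The time primitive of a compactly supported smooth function is smooth. -/
theorem contDiff_integral_Ioi {G : ℝ × Space d → ℝ} (hG : ContDiff ℝ 1 G)
    (hGc : HasCompactSupport G) :
    ContDiff ℝ 1 fun p : ℝ × Space d => ∫ s in Ioi p.1, G (s, p.2) := by
  -- The primitive is the convolution in time of `G(·,x)` with the indicator of `(-∞,0)`, with `x`
  -- as a parameter.
  have h := contDiffOn_convolution_right_with_param (𝕜 := ℝ) (μ := volume) (n := 1)
    (f := (Iio (0 : ℝ)).indicator (1 : ℝ → ℝ)) (ContinuousLinearMap.mul ℝ ℝ)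
    (g := fun (x : Space d) (s : ℝ) => G (s, x)) (s := univ) (k := Prod.fst '' tsupport G)
    isOpen_univ (hGc.isCompact.image continuous_fst)
    (fun x s _ hs => by
      by_contra hne
      exact hs ⟨(s, x), subset_tsupport _ hne, rfl⟩)
    ((locallyIntegrable_const 1).indicator measurableSet_Iio)
    (by
      have : ContDiff ℝ 1 fun q : Space d × ℝ => G (q.2, q.1) :=
        hG.comp (contDiff_snd.prodMk contDiff_fst)
      exact this.contDiffOn)
  rw [univ_prod_univ, contDiffOn_univ] at h
  have h' := h.comp (contDiff_snd.prodMk contDiff_fst : ContDiff ℝ 1 fun p : ℝ × Space d => (p.2, p.1))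
  have h1 : ContDiff ℝ ((1 : ℕ∞) : WithTop ℕ∞) fun p : ℝ × Space d =>
      ∫ s in Ioi p.1, G (s, p.2) := by
    convert h' using 1
    ext p
    simp only [Function.comp, convolution_eq_swap]
    rw [← integral_indicator measurableSet_Ioi]
    refine integral_congr_ae (.of_forall fun s => ?_)
    by_cases h : p.1 < s <;> simp [indicator, h]
  exact h1

/-- The right side is `C¹` on the whole space when `G` is, whereas the primitive itself is constant
in `t` outside `[0,T]` and may have kinks at the endpoints. -/
theorem terminalPrimitive_eq_sub {G : ℝ × Space d → ℝ} (hG : Continuous G)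
    (hGc : HasCompactSupport G) {p : ℝ × Space d} (hp : p.1 ∈ Icc 0 T) :
    terminalPrimitive T G p = (∫ s in Ioi p.1, G (s, p.2)) - ∫ s in Ioi T, G (s, p.2) := by
  have hc : HasCompactSupport fun s => G (s, p.2) :=
    HasCompactSupport.of_support_subset_isCompact (hGc.isCompact.image continuous_fst)
      fun s hs => ⟨(s, p.2), subset_tsupport _ hs, rfl⟩
  have hi : Integrable fun s => G (s, p.2) :=
    (hG.comp (by fun_prop : Continuous fun s => (s, p.2))).integrable_of_hasCompactSupport hc
  have h1 := terminalPrimitive_of_le (G := G) hp p.2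
  rw [intervalIntegral.integral_Ioi_sub_Ioi hi.integrableOn hp.2]
  exact h1

theorem contDiff_terminalPrimitive_sub {G : ℝ × Space d → ℝ} (hG : ContDiff ℝ 1 G)
    (hGc : HasCompactSupport G) :
    ContDiff ℝ 1 fun p : ℝ × Space d =>
      (∫ s in Ioi p.1, G (s, p.2)) - ∫ s in Ioi T, G (s, p.2) := by
  have h := contDiff_integral_Ioi hG hGc
  exact h.sub (h.comp (contDiff_const.prodMk contDiff_snd : ContDiff ℝ 1 fun p : ℝ × Space d => (T, p.2)))

theorem formalAdjoint_terminalPrimitive {C G : ℝ × Space d → ℝ} (hG : Continuous G)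
    {p : ℝ × Space d} (hp : p.1 ∈ Ioo 0 T) :
    formalAdjoint C (terminalPrimitive T G) p = G p + C p * terminalPrimitive T G p := by
  have hg : Continuous fun s => G (s, p.2) := by fun_prop
  have h1 : HasDerivAt (fun t => ∫ s in t..T, G (s, p.2)) (-G p) p.1 :=
    intervalIntegral.integral_hasDerivAt_left (hg.intervalIntegrable _ _)
      (hg.stronglyMeasurableAtFilter _ _) hg.continuousAt
  have h2 : (fun t => terminalPrimitive T G (t, p.2)) =ᶠ[𝓝 p.1]
      fun t => ∫ s in t..T, G (s, p.2) := by
    filter_upwards [Ioo_mem_nhds hp.1 hp.2] with t ht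
    exact terminalPrimitive_of_le (Ioo_subset_Icc_self ht) p.2
  simp [formalAdjoint, (h1.congr_of_eventuallyEq h2).deriv]

/-- A bounded measurable coefficient acts on `L²`. -/
theorem memLp_two_mul_of_bdd {α : Type*} [MeasurableSpace α] {μ : Measure α} {C V : α → ℝ} {M : ℝ}
    (hC : AEStronglyMeasurable C μ) (hM : ∀ᵐ p ∂μ, |C p| ≤ M) (hV : MemLp V 2 μ) :
    MemLp (fun p => C p * V p) 2 μ := by
  refine hV.of_le_mul (c := M) (hC.mul hV.1) ?_
  filter_upwards [hM] with p hp
  rw [norm_mul]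
  exact mul_le_mul_of_nonneg_right hp (norm_nonneg _)

theorem isSmoothTest_terminalPrimitive (hD : IsBoundedLipschitzDomain D)
    {C G : ℝ × Space d → ℝ} {M : ℝ} (hT : 0 < T)
    (hC : AEStronglyMeasurable C (cylinderMeasure T D))
    (hM : ∀ᵐ p ∂cylinderMeasure T D, |C p| ≤ M)
    (hG : ContDiff ℝ 1 G) (hGc : HasCompactSupport G) :
    IsSmoothTest T D C (terminalPrimitive T G) := by
  have hsm := contDiff_terminalPrimitive_sub (T := T) hG hGc
  have := hD.isFiniteMeasure_cylinderMeasure T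
  have hG2 : MemLp G 2 (cylinderMeasure T D) := hG.continuous.memLp_of_hasCompactSupport hGc
  refine ⟨?_, ?_, fun x _ => ?_, ?_⟩
  · exact hsm.continuous.continuousOn.congr fun p hp =>
      terminalPrimitive_eq_sub hG.continuous hGc hp.1
  · exact hsm.contDiffOn.congr fun p hp =>
      terminalPrimitive_eq_sub hG.continuous hGc (Ioo_subset_Icc_self hp.1)
  · simpa using terminalPrimitive_of_le (G := G) (right_mem_Icc.2 hT.le) x
  · refine (hG2.add (memLp_two_mul_of_bdd hC hM
      (memLp_terminalPrimitive hG.continuous.measurable hG2))).ae_eq ?_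
    filter_upwards [ae_restrict_mem (measurableSet_spaceTimeCylinder hD T)] with p hp
    exact (formalAdjoint_terminalPrimitive hG.continuous hp.1).symm

theorem tendsto_eLpNorm_of_le_const_mul {α β : Type*} [MeasurableSpace α] [MeasurableSpace β]
    {μ : Measure α} {ν : Measure β} {f : ℕ → α → ℝ} {g : ℕ → β → ℝ} {A : ℝ≥0∞} (hA : A ≠ ∞)
    (hg : Tendsto (fun k => eLpNorm (g k) 2 ν) atTop (𝓝 0))
    (h : ∀ k, eLpNorm (f k) 2 μ ≤ A * eLpNorm (g k) 2 ν) :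
    Tendsto (fun k => eLpNorm (f k) 2 μ) atTop (𝓝 0) := by
  have := ENNReal.Tendsto.const_mul hg (Or.inr hA)
  rw [mul_zero] at this
  exact tendsto_of_tendsto_of_tendsto_of_le_of_le tendsto_const_nhds this (fun _ => zero_le) h

/-- The primitive of any `L²` function belongs to the test space. -/
theorem isTestFunction_terminalPrimitive (hD : IsBoundedLipschitzDomain D)
    {C G : ℝ × Space d → ℝ} {M : ℝ} (hT : 0 < T)
    (hC : AEStronglyMeasurable C (cylinderMeasure T D))
    (hM : ∀ᵐ p ∂cylinderMeasure T D, |C p| ≤ M)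
    (hG : Measurable G) (hG2 : MemLp G 2 (cylinderMeasure T D)) :
    IsTestFunction T D C (terminalPrimitive T G) (fun p => G p + C p * terminalPrimitive T G p)
      (fun x => terminalPrimitive T G (0, x)) := by
  have := hD.isFiniteMeasure
  have := hD.isFiniteMeasure_cylinderMeasure T
  have hV := memLp_terminalPrimitive hG hG2
  refine ⟨hV, hG2.add (memLp_two_mul_of_bdd hC hM hV), memLp_terminalPrimitive_zero hG hG2, ?_⟩
  -- The primitive and its trace depend continuously on `G` in `L²`, so all three limits reduce to
  -- the `L²` approximation of `G` by compactly supported `C¹` functions.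
  have happ : ∀ k : ℕ, ∃ g : ℝ × Space d → ℝ, HasCompactSupport g ∧ ContDiff ℝ 1 g ∧
      eLpNorm (fun p => g p - G p) 2 (cylinderMeasure T D) ≤ ENNReal.ofReal (1 / (k + 1)) := by
    intro k
    obtain ⟨g, hg1, hg2, hg3⟩ := hG2.exist_eLpNorm_sub_le (by norm_num) one_le_two
      (ε := 1 / ((k : ℝ) + 1)) (by positivity)
    refine ⟨g, hg1, hg2.of_le (by exact_mod_cast le_top), ?_⟩
    rw [eLpNorm_sub_comm] at hg3
    exact hg3
  choose g hgc hg hgG using happ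
  have hgm : ∀ k, Measurable (g k) := fun k => (hg k).continuous.measurable
  have hg2 : ∀ k, MemLp (g k) 2 (cylinderMeasure T D) := fun k =>
    (hg k).continuous.memLp_of_hasCompactSupport (hgc k)
  have hlim : Tendsto (fun k => eLpNorm (fun p => g k p - G p) 2 (cylinderMeasure T D))
      atTop (𝓝 0) := by
    refine tendsto_of_tendsto_of_tendsto_of_le_of_le tendsto_const_nhds ?_ (fun _ => zero_le) hgG
    simpa using ENNReal.tendsto_ofReal tendsto_one_div_add_atTop_nhds_zero_nat
  have hsub := fun k => terminalPrimitive_sub_ae (hg2 k) hG2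
  have hsubQ : ∀ k, (fun p => terminalPrimitive T (g k) p - terminalPrimitive T G p)
      =ᵐ[cylinderMeasure T D] terminalPrimitive T fun p => g k p - G p := by
    intro k
    rw [cylinderMeasure_eq_prod]
    filter_upwards [Measure.quasiMeasurePreserving_snd.ae (hsub k)] with p hp
    exact (hp p.1).symm
  have hVlim : Tendsto (fun k => eLpNorm (fun p => terminalPrimitive T (g k) p -
      terminalPrimitive T G p) 2 (cylinderMeasure T D)) atTop (𝓝 0) := by
    refine tendsto_eLpNorm_of_le_const_mul (ENNReal.ofReal_ne_top (r := T)) hlim fun k => ?_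
    rw [eLpNorm_congr_ae (hsubQ k)]
    exact eLpNorm_terminalPrimitive_le ((hgm k).sub hG)
  refine ⟨fun k => terminalPrimitive T (g k),
    fun k => isSmoothTest_terminalPrimitive hD hT hC hM (hg k) (hgc k), hVlim, ?_, ?_⟩
  · have hsum := hlim.add (ENNReal.Tendsto.const_mul hVlim
      (Or.inr (ENNReal.ofReal_ne_top (r := M))))
    rw [mul_zero, add_zero] at hsum
    refine tendsto_of_tendsto_of_tendsto_of_le_of_le tendsto_const_nhds hsum
      (fun _ => zero_le) fun k => ?_
    have hd2 : MemLp (fun p => terminalPrimitive T (g k) p - terminalPrimitive T G p) 2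
      (cylinderMeasure T D) := (memLp_terminalPrimitive (hgm k) (hg2 k)).sub hV
    have h1 : (fun p => formalAdjoint C (terminalPrimitive T (g k)) p -
        (G p + C p * terminalPrimitive T G p)) =ᵐ[cylinderMeasure T D]
        (fun p => g k p - G p) +
          fun p => C p * (terminalPrimitive T (g k) p - terminalPrimitive T G p) := by
      filter_upwards [ae_restrict_mem (measurableSet_spaceTimeCylinder hD T)] with p hp
      rw [formalAdjoint_terminalPrimitive (hg k).continuous hp.1]
      simp only [Pi.add_apply]
      ring
    rw [eLpNorm_congr_ae h1]
    refine (eLpNorm_add_le ((hg2 k).sub hG2).1 (hC.mul hd2.1) one_le_two).trans ?_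
    refine add_le_add le_rfl ?_
    refine eLpNorm_le_mul_eLpNorm_of_ae_le_mul ?_ 2
    filter_upwards [hM] with p hp
    rw [Pi.mul_apply, norm_mul]
    exact mul_le_mul_of_nonneg_right hp (norm_nonneg _)
  · refine tendsto_eLpNorm_of_le_const_mul
      (A := ENNReal.ofReal T ^ (1 / 2 : ℝ))
      (ENNReal.rpow_lt_top_of_nonneg (by norm_num) ENNReal.ofReal_ne_top).ne hlim fun k => ?_
    rw [eLpNorm_congr_ae ((hsub k).mono fun x hx => (hx 0).symm)]
    exact eLpNorm_terminalPrimitive_zero_le ((hgm k).sub hG)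

/-! ### The a priori bound. -/

theorem lintegral_exp_kernel_sq_le {l : ℝ} (hl : 0 < l) (t : ℝ) :
    ∫⁻ s in Ioo 0 T, ‖(Ioi t).indicator (fun s => Real.exp (-l * (s - t))) s‖ₑ ^ 2 ≤
      ENNReal.ofReal (1 / (2 * l)) := by
  have h1 : ∀ s, ‖(Ioi t).indicator (fun s => Real.exp (-l * (s - t))) s‖ₑ ^ 2 =
      (Ioi t).indicator (fun s => ENNReal.ofReal (Real.exp (2 * l * t) * Real.exp (-(2 * l) * s))) s := by
    intro s
    by_cases h : t < s
    · simp only [indicator, mem_Ioi, h, if_true]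
      rw [Real.enorm_eq_ofReal (Real.exp_pos _).le, ← ENNReal.ofReal_pow (Real.exp_pos _).le,
        ← Real.exp_nat_mul, ← Real.exp_add]
      congr 2
      push_cast
      ring
    · simp [indicator, h]
  simp_rw [h1]
  refine (lintegral_mono' Measure.restrict_le_self le_rfl).trans ?_
  rw [lintegral_indicator measurableSet_Ioi, ← ofReal_integral_eq_lintegral_ofReal]
  · rw [integral_const_mul, integral_exp_mul_Ioi (by linarith)]
    refine ENNReal.ofReal_le_ofReal (le_of_eq ?_)
    rw [neg_div_neg_eq, mul_div_assoc', ← Real.exp_add]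
    simp
  · exact (integrableOn_exp_mul_Ioi (by linarith) t).const_mul _
  · exact .of_forall fun s => by positivity

/-- A priori bound for variational solutions with bounded absorption. -/
theorem IsVariationalSolution.exists_bound (hD : IsBoundedLipschitzDomain D) (hT : 0 < T) (M : ℝ) :
    ∃ A : ℝ, 0 ≤ A ∧ ∀ (C F : ℝ × Space d → ℝ) (Ubar : Space d → ℝ) (U : ℝ × Space d → ℝ),
      AEStronglyMeasurable C (cylinderMeasure T D) →
      (∀ᵐ p ∂cylinderMeasure T D, |C p| ≤ M) → MemLp F 2 (cylinderMeasure T D) →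
      MemLp Ubar 2 (volume.restrict D) → IsVariationalSolution T D C F Ubar U →
      (eLpNorm U 2 (cylinderMeasure T D)).toReal ≤
        A * ((eLpNorm F 2 (cylinderMeasure T D)).toReal +
          (eLpNorm Ubar 2 (volume.restrict D)).toReal) := by
  -- Chosen so that `M²T/(2l) ≤ 1/4`; the summand `1` keeps `l` positive when `M = 0`.
  set l : ℝ := 2 * M ^ 2 * T + 1 with hl
  have hl0 : 0 < l := by positivity
  -- `exp (l * T)` removes the weight, `2` comes from absorbing half of the square, and `T` and `√T`
  -- bound the primitive and its trace.
  refine ⟨Real.exp (l * T) * (2 * (T + Real.sqrt T)), by positivity, ?_⟩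
  intro C F Ubar U hC hM hF hUbar hU
  obtain ⟨hU2, hvar⟩ := hU
  set μ := cylinderMeasure T D with hμ
  have hcyl : ∀ᵐ p ∂μ, p ∈ spaceTimeCylinder T D :=
    ae_restrict_mem (measurableSet_spaceTimeCylinder hD T)
  set Um := hU2.1.mk U with hUm
  have hUmm : Measurable Um := hU2.1.stronglyMeasurable_mk.measurable
  have hUU : U =ᵐ[μ] Um := hU2.1.ae_eq_mk
  let e : ℝ × Space d → ℝ := fun p => Real.exp (-l * p.1)
  have he : Measurable e := by fun_prop
  have he0 : ∀ p, 0 < e p := fun p => Real.exp_pos _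
  have he1 : ∀ᵐ p ∂μ, |e p| ≤ 1 := by
    filter_upwards [hcyl] with p hp
    rw [abs_of_pos (he0 p)]
    exact Real.exp_le_one_iff.2 (by nlinarith [hp.1.1])
  -- With `w = e^{-lt}U` and `G = e^{-2lt}U`, the pairing of `U` with `G` is exactly `‖w‖²`.
  let w : ℝ × Space d → ℝ := fun p => e p * Um p
  let G : ℝ × Space d → ℝ := fun p => e p * w p
  have hwm : Measurable w := he.mul hUmm
  have hGm : Measurable G := he.mul hwm
  have hw2 : MemLp w 2 μ := memLp_two_mul_of_bdd he.aestronglyMeasurable he1 (hU2.ae_eq hUU)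
  have hG2 : MemLp G 2 μ := memLp_two_mul_of_bdd he.aestronglyMeasurable he1 hw2
  let V := terminalPrimitive T G
  have hV2 : MemLp V 2 μ := memLp_terminalPrimitive hGm hG2
  -- Since `V = e^{-lt} y`, the absorption term is the pairing of `w` with `C y`, and the kernel
  -- `e^{-l(s-t)}` makes `y` small relative to `w`.
  let y : ℝ × Space d → ℝ := fun p =>
    ∫ s in Ioo 0 T, (Ioi p.1).indicator (fun s => Real.exp (-l * (s - p.1))) s * w (s, p.2)
  have hyV : ∀ p, V p = e p * y p := by
    intro p
    simp only [V, y, terminalPrimitive]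
    rw [← integral_const_mul]
    refine integral_congr_ae (.of_forall fun s => ?_)
    by_cases h : p.1 < s
    · have h3 : Real.exp (-l * s) = Real.exp (-l * p.1) * Real.exp (-l * (s - p.1)) := by
        rw [← Real.exp_add]; ring_nf
      simp only [indicator, mem_Ioi, h, if_true, Pi.one_apply, one_mul]
      change Real.exp (-l * s) * w (s, p.2) = Real.exp (-l * p.1) * _
      rw [h3, mul_assoc]
    · simp [indicator, h]
  have hyV' : y = fun p => Real.exp (l * p.1) * V p := by
    ext p
    rw [hyV, ← mul_assoc, ← Real.exp_add]
    simp
  have hy2' : eLpNorm y 2 μ ^ 2 ≤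
      ENNReal.ofReal T * (ENNReal.ofReal (1 / (2 * l)) * eLpNorm w 2 μ ^ 2) := by
    rw [eLpNorm_two_sq, eLpNorm_two_sq, hμ, cylinderMeasure_eq_prod]
    refine (lintegral_prod_enorm_integral_mul_sq_le
      (k := fun t => (Ioi t).indicator fun s => Real.exp (-l * (s - t)))
      (fun t => (Measurable.indicator (by fun_prop) measurableSet_Ioi).aemeasurable) hwm
      fun t => lintegral_exp_kernel_sq_le hl0 t).trans_eq ?_
    simp
  have hVm : Measurable V := measurable_terminalPrimitive hGm
  have hym : Measurable y := by rw [hyV']; fun_prop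
  have hy2 : MemLp y 2 μ := by
    refine ⟨hym.aestronglyMeasurable, ?_⟩
    have : eLpNorm y 2 μ ^ 2 < ∞ := hy2'.trans_lt (ENNReal.mul_lt_top ENNReal.ofReal_lt_top
      (ENNReal.mul_lt_top ENNReal.ofReal_lt_top (ENNReal.pow_lt_top hw2.2)))
    by_contra hne
    rw [not_lt_top_iff] at hne
    simp [hne] at this
  set Nw := (eLpNorm w 2 μ).toReal with hNw
  set Ny := (eLpNorm y 2 μ).toReal with hNy
  have hNy2 : Ny ^ 2 ≤ T * (1 / (2 * l) * Nw ^ 2) := by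
    have := ENNReal.toReal_mono (by
      refine (ENNReal.mul_lt_top ENNReal.ofReal_lt_top
        (ENNReal.mul_lt_top ENNReal.ofReal_lt_top (ENNReal.pow_lt_top hw2.2))).ne) hy2'
    simpa [ENNReal.toReal_mul, ENNReal.toReal_ofReal hT.le, hl0.le] using this
  have hNw0 : 0 ≤ Nw := ENNReal.toReal_nonneg
  have hNy0 : 0 ≤ Ny := ENNReal.toReal_nonneg
  have hMy : |M| * Ny ≤ Nw / 2 := by
    refine abs_le_of_sq_le_sq' ?_ (by positivity) |>.2
    have h1 : (M ^ 2 * T) / (2 * l) ≤ 1 / 4 := by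
      rw [div_le_div_iff₀ (by positivity) (by norm_num)]
      nlinarith [sq_nonneg M]
    calc (|M| * Ny) ^ 2 = M ^ 2 * Ny ^ 2 := by rw [mul_pow, sq_abs]
      _ ≤ M ^ 2 * (T * (1 / (2 * l) * Nw ^ 2)) := by gcongr
      _ = (M ^ 2 * T) / (2 * l) * Nw ^ 2 := by ring
      _ ≤ 1 / 4 * Nw ^ 2 := by gcongr
      _ = (Nw / 2) ^ 2 := by ring
  have hNG : (eLpNorm G 2 μ).toReal ≤ Nw := by
    refine ENNReal.toReal_mono hw2.2.ne (eLpNorm_mono_ae ?_)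
    filter_upwards [he1] with p hp
    rw [norm_mul]
    exact mul_le_of_le_one_left (norm_nonneg _) hp
  have hNV : (eLpNorm V 2 μ).toReal ≤ T * Nw := by
    have := ENNReal.toReal_mono (ENNReal.mul_lt_top ENNReal.ofReal_lt_top hG2.2).ne
      (eLpNorm_terminalPrimitive_le (T := T) (D := D) hGm)
    rw [ENNReal.toReal_mul, ENNReal.toReal_ofReal hT.le] at this
    exact this.trans (by gcongr)
  have hNV0 : (eLpNorm (fun x => V (0, x)) 2 (volume.restrict D)).toReal ≤ Real.sqrt T * Nw := by
    have := ENNReal.toReal_mono (ENNReal.mul_lt_top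
      (ENNReal.rpow_lt_top_of_nonneg (by norm_num) ENNReal.ofReal_ne_top) hG2.2).ne
      (eLpNorm_terminalPrimitive_zero_le (T := T) (D := D) hGm)
    rw [ENNReal.toReal_mul, ← ENNReal.toReal_rpow, ENNReal.toReal_ofReal hT.le,
      ← Real.sqrt_eq_rpow] at this
    exact this.trans (by gcongr)
  have hid := hvar _ _ _ (isTestFunction_terminalPrimitive hD hT hC hM hGm hG2)
  have hCy : MemLp (fun p => C p * y p) 2 μ := memLp_two_mul_of_bdd hC hM hy2
  have hlhs : ∫ p in spaceTimeCylinder T D, U p * (G p + C p * terminalPrimitive T G p) =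
      Nw ^ 2 + ∫ p, w p * (C p * y p) ∂μ := by
    rw [← integral_mul_self_eq hw2, ← integral_add (integrable_mul_of_memLp_two hw2 hw2)
      (integrable_mul_of_memLp_two hw2 hCy)]
    refine integral_congr_ae ?_
    filter_upwards [hUU] with p hp
    rw [hp, show terminalPrimitive T G p = e p * y p from hyV p]
    simp only [G, w]
    ring
  have hcross : |∫ p, w p * (C p * y p) ∂μ| ≤ Nw * (Nw / 2) := by
    refine (abs_integral_mul_le hw2 hCy).trans (mul_le_mul_of_nonneg_left ?_ hNw0)
    refine le_trans ?_ hMy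
    have : eLpNorm (fun p => C p * y p) 2 μ ≤ ENNReal.ofReal |M| * eLpNorm y 2 μ := by
      refine eLpNorm_le_mul_eLpNorm_of_ae_le_mul ?_ 2
      filter_upwards [hM] with p hp
      rw [norm_mul]
      exact mul_le_mul_of_nonneg_right (hp.trans (le_abs_self M)) (norm_nonneg _)
    have := ENNReal.toReal_mono (ENNReal.mul_lt_top ENNReal.ofReal_lt_top hy2.2).ne this
    rwa [ENNReal.toReal_mul, ENNReal.toReal_ofReal (abs_nonneg M)] at this
  have hrF : |∫ p in spaceTimeCylinder T D, F p * terminalPrimitive T G p| ≤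
      (eLpNorm F 2 μ).toReal * (T * Nw) :=
    (abs_integral_mul_le hF hV2).trans (by gcongr)
  have hrU : |∫ x in D, Ubar x * terminalPrimitive T G (0, x)| ≤
      (eLpNorm Ubar 2 (volume.restrict D)).toReal * (Real.sqrt T * Nw) :=
    (abs_integral_mul_le hUbar (memLp_terminalPrimitive_zero hGm hG2)).trans (by gcongr)
  set NF := (eLpNorm F 2 μ).toReal with hNF
  set NU := (eLpNorm Ubar 2 (volume.restrict D)).toReal with hNU
  have hNF0 : 0 ≤ NF := ENNReal.toReal_nonneg
  have hNU0 : 0 ≤ NU := ENNReal.toReal_nonneg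
  have hsT : 0 ≤ Real.sqrt T := Real.sqrt_nonneg T
  have hmain : Nw ≤ 2 * (T + Real.sqrt T) * (NF + NU) := by
    -- The cross term takes away at most half of `Nw ^ 2`. One factor `Nw` is cancelled afterwards,
    -- the case `Nw = 0` being trivial.
    have h1 : Nw * Nw ≤ Nw * (2 * (T * NF + Real.sqrt T * NU)) := by
      rw [hlhs] at hid
      nlinarith [abs_le.1 hcross, abs_le.1 hrF, abs_le.1 hrU]
    have h2 : Nw ≤ 2 * (T * NF + Real.sqrt T * NU) := by
      rcases hNw0.eq_or_lt with h | h
      · rw [← h]; positivity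
      · exact le_of_mul_le_mul_left h1 h
    nlinarith [mul_nonneg hT.le hNU0, mul_nonneg hsT hNF0]
  have hUw : (eLpNorm U 2 μ).toReal ≤ Real.exp (l * T) * Nw := by
    have : eLpNorm U 2 μ ≤ ENNReal.ofReal (Real.exp (l * T)) * eLpNorm w 2 μ := by
      refine eLpNorm_le_mul_eLpNorm_of_ae_le_mul ?_ 2
      filter_upwards [hUU, hcyl] with p hp hpQ
      have h1 : U p = Real.exp (l * p.1) * w p := by
        rw [hp]
        simp only [w, e]
        rw [← mul_assoc, ← Real.exp_add]
        simp
      rw [h1, norm_mul, Real.norm_of_nonneg (Real.exp_pos _).le]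
      exact mul_le_mul_of_nonneg_right
        (Real.exp_le_exp.2 (mul_le_mul_of_nonneg_left hpQ.1.2.le hl0.le)) (norm_nonneg _)
    have := ENNReal.toReal_mono (ENNReal.mul_lt_top ENNReal.ofReal_lt_top hw2.2).ne this
    rwa [ENNReal.toReal_mul, ENNReal.toReal_ofReal (Real.exp_pos _).le] at this
  calc _ ≤ _ := hUw
    _ ≤ Real.exp (l * T) * (2 * (T + Real.sqrt T) * (NF + NU)) := by gcongr
    _ = _ := by ring

/-! ### Smooth test functions and stability of variational solutions. -/

theorem IsSmoothTest.exists_bound (hD : IsBoundedLipschitzDomain D) {C V : ℝ × Space d → ℝ}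
    (h : IsSmoothTest T D C V) : ∃ B : ℝ, ∀ p ∈ closedSpaceTimeCylinder T D, |V p| ≤ B :=
  (isCompact_closedSpaceTimeCylinder hD T).exists_bound_of_continuousOn h.continuousOn

theorem IsSmoothTest.memLp_self (hD : IsBoundedLipschitzDomain D) {C V : ℝ × Space d → ℝ}
    (h : IsSmoothTest T D C V) : MemLp V 2 (cylinderMeasure T D) := by
  have := hD.isFiniteMeasure_cylinderMeasure T
  have hm := measurableSet_spaceTimeCylinder hD T
  obtain ⟨B, hB⟩ := h.exists_bound hD
  refine MemLp.of_bound ((h.continuousOn.mono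
    (spaceTimeCylinder_subset_closed T D)).aestronglyMeasurable hm) B ?_
  filter_upwards [ae_restrict_mem hm] with p hp
  exact hB p (spaceTimeCylinder_subset_closed T D hp)

theorem formalAdjoint_eq_add (C C' V : ℝ × Space d → ℝ) (p : ℝ × Space d) :
    formalAdjoint C' V p = formalAdjoint C V p + (C' p - C p) * V p := by
  simp only [formalAdjoint]; ring

/-- The two formal adjoints differ by a bounded multiple of `V ∈ L²(Q)`. Hence one fixed `V` can
test all the approximating equations. -/
theorem IsSmoothTest.congr_coefficient (hD : IsBoundedLipschitzDomain D)
    {C C' V : ℝ × Space d → ℝ} {M : ℝ} (h : IsSmoothTest T D C V)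
    (hC : AEStronglyMeasurable C (cylinderMeasure T D))
    (hC' : AEStronglyMeasurable C' (cylinderMeasure T D))
    (hM : ∀ᵐ p ∂cylinderMeasure T D, |C' p - C p| ≤ M) : IsSmoothTest T D C' V := by
  refine ⟨h.continuousOn, h.contDiffOn, h.final, ?_⟩
  have h1 := h.memLp.add (memLp_two_mul_of_bdd (hC'.sub hC) hM (h.memLp_self hD))
  exact h1.ae_eq (.of_forall fun p => (formalAdjoint_eq_add C C' V p).symm)

theorem IsSmoothTest.memLp_trace (hD : IsBoundedLipschitzDomain D) (hT : 0 < T)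
    {C V : ℝ × Space d → ℝ} (h : IsSmoothTest T D C V) :
    MemLp (fun x => V (0, x)) 2 (volume.restrict D) := by
  have := hD.isFiniteMeasure
  have hm := hD.isOpen.measurableSet
  have h0 : ∀ x ∈ D, ((0 : ℝ), x) ∈ closedSpaceTimeCylinder T D := fun x hx =>
    ⟨left_mem_Icc.2 hT.le, subset_closure hx⟩
  obtain ⟨B, hB⟩ := h.exists_bound hD
  refine MemLp.of_bound ((h.continuousOn.comp (by fun_prop) h0).aestronglyMeasurable hm) B ?_
  filter_upwards [ae_restrict_mem hm] with x hx
  exact hB _ (h0 x hx)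

theorem IsSmoothTest.isTestFunction (hD : IsBoundedLipschitzDomain D) (hT : 0 < T)
    {C V : ℝ × Space d → ℝ} (h : IsSmoothTest T D C V) :
    IsTestFunction T D C V (formalAdjoint C V) (fun x => V (0, x)) :=
  ⟨h.memLp_self hD, h.memLp, h.memLp_trace hD hT, fun _ => V, fun _ => h, by simp, by simp, by simp⟩

/-- It suffices to test with smooth functions. -/
theorem isVariationalSolution_of_smooth (hD : IsBoundedLipschitzDomain D) (hT : 0 < T)
    {C F U : ℝ × Space d → ℝ} {Ubar : Space d → ℝ}
    (hU : MemLp U 2 (cylinderMeasure T D)) (hF : MemLp F 2 (cylinderMeasure T D))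
    (hUbar : MemLp Ubar 2 (volume.restrict D))
    (h : ∀ V, IsSmoothTest T D C V → ∫ p, U p * formalAdjoint C V p ∂cylinderMeasure T D =
      (∫ p, F p * V p ∂cylinderMeasure T D) + ∫ x in D, Ubar x * V (0, x)) :
    IsVariationalSolution T D C F Ubar U := by
  refine ⟨hU, fun V W V₀ ⟨hV, hW, hV₀, Vk, hk, h1, h2, h3⟩ => ?_⟩
  -- Every term of the identity is continuous under the three convergences that define the closure.
  have l1 := (weakL2Tendsto_const hF).tendsto_integral_mul (fun k => (hk k).memLp_self hD) hV h1
  have l2 := (weakL2Tendsto_const hU).tendsto_integral_mul (fun k => (hk k).memLp) hW h2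
  have l3 := (weakL2Tendsto_const hUbar).tendsto_integral_mul
    (fun k => (hk k).memLp_trace hD hT) hV₀ h3
  exact tendsto_nhds_unique l2 ((l1.add l3).congr fun k => (h _ (hk k)).symm)

/-- Bounded pointwise convergent coefficients act strongly continuously on bounded functions. -/
theorem tendsto_eLpNorm_mul_zero {α : Type*} [MeasurableSpace α] {μ : Measure α}
    [IsFiniteMeasure μ] {c : ℕ → α → ℝ} {V : α → ℝ} {B : ℝ}
    (hc : ∀ n, AEStronglyMeasurable (c n) μ) (hV : AEStronglyMeasurable V μ)
    (hB : ∀ n, ∀ᵐ p ∂μ, |c n p * V p| ≤ B)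
    (hlim : ∀ᵐ p ∂μ, Tendsto (fun n => c n p) atTop (𝓝 0)) :
    Tendsto (fun n => eLpNorm (fun p => c n p * V p) 2 μ) atTop (𝓝 0) := by
  have h1 : Tendsto (fun n => ∫⁻ p, ‖c n p * V p‖ₑ ^ 2 ∂μ) atTop (𝓝 (∫⁻ _, 0 ∂μ)) := by
    refine tendsto_lintegral_of_dominated_convergence' (fun _ => ENNReal.ofReal B ^ 2)
      (fun n => ((hc n).mul hV).enorm.pow_const 2) (fun n => ?_) ?_ ?_
    · filter_upwards [hB n] with p hp
      gcongr
      rw [Real.enorm_eq_ofReal_abs]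
      exact ENNReal.ofReal_le_ofReal hp
    · rw [lintegral_const]
      exact (ENNReal.mul_lt_top (ENNReal.pow_lt_top ENNReal.ofReal_lt_top)
        (measure_lt_top μ univ)).ne
    · filter_upwards [hlim] with p hp
      have h2 := ((ENNReal.continuous_pow 2).tendsto _).comp (hp.mul_const (V p)).enorm
      simpa [Function.comp_def] using h2
  have h3 := (ENNReal.continuous_rpow_const (y := 1 / 2)).continuousAt.tendsto.comp h1
  simp only [lintegral_zero] at h3
  rw [ENNReal.zero_rpow_of_pos (by norm_num)] at h3
  refine h3.congr fun n => ?_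
  rw [Function.comp, ← eLpNorm_two_sq, ← ENNReal.rpow_natCast, ← ENNReal.rpow_mul]
  norm_num

/-- Stability of variational solutions under weak convergence of the data and pointwise
bounded convergence of the absorption. -/
theorem isVariationalSolution_of_tendsto (hD : IsBoundedLipschitzDomain D) (hT : 0 < T)
    {C F U : ℕ → ℝ × Space d → ℝ} {Ubar : ℕ → Space d → ℝ} {C' F' U' : ℝ × Space d → ℝ}
    {Ubar' : Space d → ℝ} {M : ℝ}
    (hC : ∀ n, AEStronglyMeasurable (C n) (cylinderMeasure T D))
    (hC' : AEStronglyMeasurable C' (cylinderMeasure T D))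
    (hM : ∀ n, ∀ᵐ p ∂cylinderMeasure T D, |C n p| ≤ M)
    (hClim : ∀ᵐ p ∂cylinderMeasure T D, Tendsto (fun n => C n p) atTop (𝓝 (C' p)))
    (hF : WeakL2Tendsto (cylinderMeasure T D) F F')
    (hUbar : WeakL2Tendsto (volume.restrict D) Ubar Ubar')
    (hUlim : WeakL2Tendsto (cylinderMeasure T D) U U')
    (hU : ∀ n, IsVariationalSolution T D (C n) (F n) (Ubar n) (U n)) :
    IsVariationalSolution T D C' F' Ubar' U' := by
  have := hD.isFiniteMeasure_cylinderMeasure T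
  have hm := measurableSet_spaceTimeCylinder hD T
  have hM' : ∀ᵐ p ∂cylinderMeasure T D, |C' p| ≤ M := by
    filter_upwards [hClim, ae_all_iff.2 hM] with p hp hpM
    exact le_of_tendsto hp.abs (.of_forall hpM)
  have hdiff : ∀ n, ∀ᵐ p ∂cylinderMeasure T D, |C n p - C' p| ≤ M + M := fun n => by
    filter_upwards [hM n, hM'] with p h1 h2
    exact (abs_sub _ _).trans (add_le_add h1 h2)
  refine isVariationalSolution_of_smooth hD hT hUlim.2.1 hF.2.1 hUbar.2.1 fun V hV => ?_
  have hVn : ∀ n, IsSmoothTest T D (C n) V := fun n =>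
    hV.congr_coefficient hD hC' (hC n) (hdiff n)
  have hV2 := hV.memLp_self hD
  obtain ⟨B, hB⟩ := hV.exists_bound hD
  -- The difference is `(Cₙ - C)V`, which is uniformly bounded and tends to zero a.e.
  have hstrong : Tendsto (fun n => eLpNorm (fun p => formalAdjoint (C n) V p -
      formalAdjoint C' V p) 2 (cylinderMeasure T D)) atTop (𝓝 0) := by
    have h1 := tendsto_eLpNorm_mul_zero (B := (M + M) * B) (fun n => (hC n).sub hC') hV2.1
      (fun n => by
        filter_upwards [hdiff n, ae_restrict_mem hm] with p h1 h2
        rw [abs_mul]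
        exact mul_le_mul h1 (hB p (spaceTimeCylinder_subset_closed T D h2)) (abs_nonneg _)
          ((abs_nonneg _).trans h1))
      (by
        filter_upwards [hClim] with p hp
        simpa using hp.sub_const (C' p))
    refine h1.congr fun n => ?_
    congr 1
    ext p
    rw [formalAdjoint_eq_add C' (C n) V p, add_sub_cancel_left]
    rfl
  have l2 := hUlim.tendsto_integral_mul (fun n => (hVn n).memLp) hV.memLp hstrong
  have l1 := (hF.2.2 V hV2).add (hUbar.2.2 _ (hV.memLp_trace hD hT))
  exact tendsto_nhds_unique l2
    (l1.congr fun n => ((hU n).2 _ _ _ ((hVn n).isTestFunction hD hT)).symm)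

/-! ### Induced functions. -/

/-- Every `U ∈ L²(Q)` induces a function in `L²(σ)`. -/
theorem IsUntangledFlow.exists_isInducedBy {b : ℝ × Space d → Space d}
    {X : ℝ → Space d → Space d} (hT : 0 < T) (hD : IsBoundedLipschitzDomain D)
    (h : IsUntangledFlow T D b X) {U : ℝ × Space d → ℝ} (hU : MemLp U 2 (cylinderMeasure T D)) :
    ∃ u, MemLp u 2 (spaceTimeMeasure T D X) ∧ IsInducedBy T D X u U := by
  have hfin := h.isFiniteMeasure_spaceTimeMeasure hT hD
  have hmem := h.ae_mem_closedSpaceTimeCylinder hT hD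
  have hcpt := isCompact_closedSpaceTimeCylinder hD T
  obtain ⟨Φ, hΦ, hΦX, hσ⟩ := h.exists_map_eq hT hD
  have hmp : MeasurePreserving Φ (cylinderMeasure T D) (spaceTimeMeasure T D X) := ⟨hΦ, hσ.symm⟩
  -- The defining relation of `u` says `⟨u, φ⟩ = ⟨U, φ ∘ Φ⟩`, so the adjoint of composition with `Φ`
  -- applied to `U` is the required function.
  let A : Lp ℝ 2 (spaceTimeMeasure T D X) →L[ℝ] Lp ℝ 2 (cylinderMeasure T D) :=
    (Lp.compMeasurePreservingₗᵢ ℝ Φ hmp).toContinuousLinearMap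
  let u := ContinuousLinearMap.adjoint A (hU.toLp U)
  refine ⟨u, Lp.memLp u, fun φ hφ => ?_⟩
  have hφ2 : MemLp φ 2 (spaceTimeMeasure T D X) := by
    obtain ⟨B, hB⟩ := hcpt.exists_bound_of_continuousOn hφ
    refine MemLp.of_bound ?_ B (hmem.mono hB)
    rw [← Measure.restrict_eq_self_of_ae_mem hmem]
    exact hφ.aestronglyMeasurable hcpt.measurableSet
  have h1 := inner_toLp_eq_integral (Lp.memLp u) hφ2
  rw [Lp.toLp_coeFn] at h1
  have h2 : A (hφ2.toLp φ) = (hφ2.comp_measurePreserving hmp).toLp (φ ∘ Φ) :=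
    Lp.toLp_compMeasurePreserving hφ2 hmp
  rw [← h1, ContinuousLinearMap.adjoint_inner_left, h2, inner_toLp_eq_integral]
  refine integral_congr_ae ?_
  filter_upwards [alongFlow_ae_eq hD hΦX φ] with p hp
  rw [hp]

/-- Compactly supported smooth functions are admissible `φ`, and they separate locally integrable
functions up to null sets; `σ` is finite, so `L²(σ)` functions qualify. -/
theorem IsInducedBy.ae_eq {b : ℝ × Space d → Space d}
    {X : ℝ → Space d → Space d} (hT : 0 < T) (hD : IsBoundedLipschitzDomain D)
    (h : IsUntangledFlow T D b X) {U u v : ℝ × Space d → ℝ}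
    (hu : MemLp u 2 (spaceTimeMeasure T D X)) (hv : MemLp v 2 (spaceTimeMeasure T D X))
    (huU : IsInducedBy T D X u U) (hvU : IsInducedBy T D X v U) :
    v =ᵐ[spaceTimeMeasure T D X] u := by
  have hfin := h.isFiniteMeasure_spaceTimeMeasure hT hD
  refine ae_eq_of_integral_contDiff_smul_eq (hv.integrable one_le_two).locallyIntegrable
    (hu.integrable one_le_two).locallyIntegrable fun g hg _ => ?_
  have hg' := hg.continuous.continuousOn (s := closedSpaceTimeCylinder T D)
  simp only [smul_eq_mul, mul_comm (g _)]
  rw [hvU g hg', huU g hg']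

end FlowTransport

/-! ### The stability theorem. -/

open FlowTransport
theorem mainTheorem3 {d : ℕ} (T : ℝ) (hT : 0 < T)
    (D : Set (Space d)) (hD : IsBoundedLipschitzDomain D)
    -- the approximating problems, their flow-solutions, and the generators of these
    (b : ℕ → ℝ × Space d → Space d) (X : ℕ → ℝ → Space d → Space d)
    (c f : ℕ → ℝ × Space d → ℝ) (ubar : ℕ → Space d → ℝ)
    (u U : ℕ → ℝ × Space d → ℝ)
    (hu : ∀ n, IsFlowSolution T D (b n) (X n) (c n) (f n) (ubar n) (u n))
    (hU : ∀ n, IsGenerator T D (X n) (c n) (f n) (ubar n) (u n) (U n))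
    -- the absorption coefficients remain bounded
    (hc_bdd : ∃ M : ℝ, ∀ n, ∀ᵐ p ∂spaceTimeMeasure T D (X n), |c n p| ≤ M)
    -- the limit velocity with its flow
    (b' : ℝ × Space d → Space d) (X' : ℝ → Space d → Space d)
    (hX' : IsUntangledFlow T D b' X')
    (hb_lim : ∀ᵐ p ∂volume.restrict (closedSpaceTimeCylinder T D),
      Tendsto (fun n => b n p) atTop (𝓝 (b' p)))
    (hX_lim : ∀ᵐ p ∂volume.restrict (closedSpaceTimeCylinder T D),
      Tendsto (fun n => X n p.1 p.2) atTop (𝓝 (X' p.1 p.2)))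
    -- the limit data
    (ubar' : Space d → ℝ)
    (hubar_lim : WeakL2Tendsto (volume.restrict D) ubar ubar')
    (c' f' : ℝ × Space d → ℝ)
    (hc' : MemLp c' ⊤ (spaceTimeMeasure T D X'))
    (hf' : MemLp f' 2 (spaceTimeMeasure T D X'))
    (hC_lim : ∀ᵐ p ∂volume.restrict (spaceTimeCylinder T D),
      Tendsto (fun n => alongFlow (X n) (c n) p) atTop (𝓝 (alongFlow X' c' p)))
    (hF_lim : WeakL2Tendsto (volume.restrict (spaceTimeCylinder T D))
      (fun n => alongFlow (X n) (f n)) (alongFlow X' f')) :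
    ∃ (k : ℕ → ℕ) (U' : ℝ × Space d → ℝ), StrictMono k ∧
      WeakL2Tendsto (volume.restrict (spaceTimeCylinder T D)) (fun j => U (k j)) U' ∧
      -- `U'` induces a function `u'` in `L²(σ)`, unique up to `σ`-null sets
      ∃ u' : ℝ × Space d → ℝ,
        MemLp u' 2 (spaceTimeMeasure T D X') ∧ IsInducedBy T D X' u' U' ∧
        (∀ v : ℝ × Space d → ℝ, MemLp v 2 (spaceTimeMeasure T D X') →
          IsInducedBy T D X' v U' → v =ᵐ[spaceTimeMeasure T D X'] u') ∧
        -- which is a flow-solution of the limit problem, with generator `U'`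
        IsFlowSolution T D b' X' c' f' ubar' u' ∧
        IsGenerator T D X' c' f' ubar' u' U' := by
  obtain ⟨M, hM⟩ := hc_bdd
  have hfin := hD.isFiniteMeasure_cylinderMeasure T
  have hCm : ∀ n, AEStronglyMeasurable (alongFlow (X n) (c n)) (cylinderMeasure T D) := fun n =>
    ((hu n).flow.memLp_alongFlow hT hD (hu n).data.memLp_c).1
  have hCM : ∀ n, ∀ᵐ p ∂cylinderMeasure T D, |alongFlow (X n) (c n) p| ≤ M := fun n =>
    (hu n).flow.ae_alongFlow (P := fun r => |r| ≤ M) hT hD (hM n)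
  have hC0 : ∀ n, ∀ᵐ p ∂cylinderMeasure T D, 0 ≤ alongFlow (X n) (c n) p := fun n =>
    (hu n).flow.ae_alongFlow (P := fun r => 0 ≤ r) hT hD (hu n).data.nonneg_c
  -- The sign survives the pointwise limit along the flows, and a property of `C` a.e. in `Q`
  -- becomes one of `c` `σ`-a.e. because `σ` is an image measure.
  have hc'0 : ∀ᵐ p ∂spaceTimeMeasure T D X', 0 ≤ c' p := by
    refine hX'.ae_nonneg_of_alongFlow hT hD hc'.1 ?_
    filter_upwards [hC_lim, ae_all_iff.2 hC0] with p hp hp0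
    exact ge_of_tendsto hp (.of_forall hp0)
  obtain ⟨A, hA0, hA⟩ := IsVariationalSolution.exists_bound hD hT M
  obtain ⟨KF, hKF⟩ := hF_lim.exists_bound
  obtain ⟨KU, hKU⟩ := hubar_lim.exists_bound
  have hbound : ∀ n, (eLpNorm (U n) 2 (cylinderMeasure T D)).toReal ≤ A * (KF + KU) := fun n =>
    (hA _ _ _ _ (hCm n) (hCM n) (hF_lim.1 n) (hubar_lim.1 n) (hU n).1).trans
      (mul_le_mul_of_nonneg_left (add_le_add (hKF n) (hKU n)) hA0)
  obtain ⟨k, U', hk, hlim⟩ := exists_weakL2Tendsto_subseq (fun n => (hU n).1.1) hbound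
  have hkt := hk.tendsto_atTop
  have hvar : IsVariationalSolution T D (alongFlow X' c') (alongFlow X' f') ubar' U' :=
    isVariationalSolution_of_tendsto hD hT (fun j => hCm (k j))
      (hX'.memLp_alongFlow hT hD hc').1 (fun j => hCM (k j))
      (hC_lim.mono fun p hp => hp.comp hkt)
      ⟨fun j => hF_lim.1 (k j), hF_lim.2.1, fun g hg => (hF_lim.2.2 g hg).comp hkt⟩
      ⟨fun j => hubar_lim.1 (k j), hubar_lim.2.1, fun g hg => (hubar_lim.2.2 g hg).comp hkt⟩
      hlim (fun j => (hU (k j)).1)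
  obtain ⟨u', hu', hind⟩ := hX'.exists_isInducedBy hT hD hvar.1
  exact ⟨k, U', hk, hlim, u', hu', hind,
    fun v hv hvU => IsInducedBy.ae_eq hT hD hX' hu' hv hind hvU,
    ⟨hX', ⟨hc', hc'0, hf', hubar_lim.2.1⟩, hu', U', hvar, hind⟩, hvar, hind⟩
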